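/- Let $\mathbb K$ be $\mathbb R$ or $\mathbb C$ and $n\in\mathbb N$. For a Banach space $E$ over $\mathbb K$ let $\mathcal P^n(E)$ be the space of continuous $n$-homogeneous polynomials $P:E\to\mathbb K$, i.e. functions $P(x)=A(x,\dots,x)$ with $A$ a continuous $n$-linear form, which may be taken symmetric and is then unique. A Banach ideal of $n$-homogeneous polynomials is a pair $(\mathcal Q,\|\cdot\|_{\mathcal Q})$ assigning to each Banach space $E$ a linear subspace $\mathcal Q(E)\subseteq\mathcal P^n(E)$ with a complete norm $\|\cdot\|_{\mathcal Q(E)}$ such that (a) if $T:E_1\to E$ is bounded linear and $P\in\mathcal Q(E)$, then $P\circ T\in\mathcal Q(E_1)$ and $\|P\circ T\|_{\mathcal Q(E_1)}\le\|P\|_{\mathcal Q(E)}\|T\|^n$; (b) $z\mapsto z^n$ belongs to $\mathcal Q(\mathbb K)$ and has norm $1$. An operator is approximable if it is an operator-norm limit of finite rank operators. The ideal $\mathcal Q$ is called minimal if, for every Banach space $E$, a function $P:E\to\mathbb K$ belongs to $\mathcal Q(E)$ if and only if $P=R\circ T$ for some Banach space $F$, some approximable $T:E\to F$ and some $R\in\mathcal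 Q(F)$, and in that case $\|P\|_{\mathcal Q(E)}=\inf\|R\|_{\mathcal Q(F)}\|T\|^n$, the infimum being taken over all such factorizations. For $P\in\mathcal P^n(E)$ with associated symmetric form $A$, the Aron–Berner extension $AB(P):E''\to\mathbb K$ is $AB(P)(z)=\overline A(z,\dots,z)$, where $\overline A$ is obtained from $A$ by extending the variables to $E''$ one at a time, from the last to the first, by weak-star continuity, i.e. $$\overline A(z_1,\dots,z_n)=\lim_{x_1\to z_1}\cdots\lim_{x_n\to z_n}A(x_1,\dots,x_n)$$ with iterated weak-star limits, $x_j\in E$. **Corollary 3.8.** Let $\mathcal Q$ be a minimal Banach ideal of $n$-homogeneous polynomials and $E$ a Banach space. If $P\in\mathcal Q(E)$, then $AB(P)\in\mathcal Q(E'')$ and $$\|AB(P)\|_{\mathcal Q(E'')}=\|P\|_{\mathcal Q(E)}.$$ -/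

import Mathlib

universe u v

namespace PolyIdeals

section Polynomials

variable (𝕜 : Type v) [RCLike 𝕜] (n : ℕ)
variable (E : Type u) [NormedAddCommGroup E] [NormedSpace 𝕜 E]

/-- The space of continuous scalar-valued `n`-homogeneous polynomials on `E`: the functions
`x ↦ A (x, …, x)` with `A` a continuous `n`-linear form on `E`. -/
def HomPoly : Submodule 𝕜 (E → 𝕜) where
  carrier := {P | ∃ A : ContinuousMultilinearMap 𝕜 (fun _ : Fin n => E) 𝕜,
    ∀ x, P x = A (fun _ => x)}
  add_mem' := by
    rintro P Q ⟨A, hA⟩ ⟨B, hB⟩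
    exact ⟨A + B, fun x => by simp [hA, hB]⟩
  zero_mem' := ⟨0, fun x => by simp⟩
  smul_mem' := by
    rintro c P ⟨A, hA⟩
    exact ⟨c • A, fun x => by simp [hA]⟩

variable {𝕜 n E}

/-- `A` is a symmetric continuous `n`-linear form whose restriction to the diagonal is `P`. -/
def IsAssociatedForm (P : E → 𝕜) (A : ContinuousMultilinearMap 𝕜 (fun _ : Fin n => E) 𝕜) :
    Prop :=
  (∀ (σ : Equiv.Perm (Fin n)) (x : Fin n → E), A (fun i => x (σ i)) = A x) ∧
    ∀ x, P x = A (fun _ => x)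

theorem exists_associatedForm {P : E → 𝕜} (hP : P ∈ HomPoly 𝕜 n E) :
    ∃ A : ContinuousMultilinearMap 𝕜 (fun _ : Fin n => E) 𝕜, IsAssociatedForm P A := by
  obtain ⟨A, hA⟩ := hP
  have key : ∀ x : Fin n → E, (((n.factorial : 𝕜)⁻¹ •
      ∑ σ : Equiv.Perm (Fin n), A.domDomCongr σ :
        ContinuousMultilinearMap 𝕜 (fun _ : Fin n => E) 𝕜) x) =
      (n.factorial : 𝕜)⁻¹ * ∑ σ : Equiv.Perm (Fin n), A (fun i => x (σ i)) := by
    intro x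
    simp
  refine ⟨(n.factorial : 𝕜)⁻¹ • ∑ σ : Equiv.Perm (Fin n), A.domDomCongr σ, ?_, ?_⟩
  · intro τ x
    rw [key, key]
    congr 1
    exact Fintype.sum_equiv (Equiv.mulLeft τ) _ _ (fun σ => by simp)
  · intro x
    rw [key, hA]
    have hn : (n.factorial : 𝕜) ≠ 0 := Nat.cast_ne_zero.mpr n.factorial_ne_zero
    simp [Fintype.card_perm, hn]

/-- The symmetric continuous `n`-linear form associated with a polynomial. (It is unique, by
the polarization formula.) -/
noncomputable def associatedForm {P : E → 𝕜} (hP : P ∈ HomPoly 𝕜 n E) :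
    ContinuousMultilinearMap 𝕜 (fun _ : Fin n => E) 𝕜 :=
  (exists_associatedForm hP).choose

theorem associatedForm_spec {P : E → 𝕜} (hP : P ∈ HomPoly 𝕜 n E) :
    IsAssociatedForm P (associatedForm hP) :=
  (exists_associatedForm hP).choose_spec

end Polynomials

section AronBerner

variable {𝕜 : Type v} [RCLike 𝕜] {E : Type u} [NormedAddCommGroup E] [NormedSpace 𝕜 E]

/-- The (iterated) Aron–Berner extension of an `n`-linear form to the bidual, from the last
variable to the first: the bidual element `z n` is applied to the functional
`x ↦ A (x₁, …, x₍ₙ₋₁₎, x)`, which leaves an `(n-1)`-linear form on `E`, and so on. Equivalently, it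
is the iterated weak-star limit `lim_{x₁ → z₁} ⋯ lim_{xₙ → zₙ} A (x₁, …, xₙ)`. -/
noncomputable def multilinearAB : (n : ℕ) →
    ContinuousMultilinearMap 𝕜 (fun _ : Fin n => E) 𝕜 →
    (Fin n → StrongDual 𝕜 (StrongDual 𝕜 E)) → 𝕜
  | 0, A, _ => A Fin.elim0
  | n + 1, A, z =>
      multilinearAB n ((z (Fin.last n)).compContinuousMultilinearMap A.curryRight) (Fin.init z)

/-- The Aron–Berner extension `AB(P) : E'' → 𝕜` of a continuous `n`-homogeneous polynomial. -/
noncomputable def aronBerner {n : ℕ} {P : E → 𝕜} (hP : P ∈ HomPoly 𝕜 n E) :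
    StrongDual 𝕜 (StrongDual 𝕜 E) → 𝕜 :=
  fun z => multilinearAB n (associatedForm hP) (fun _ => z)

end AronBerner

/-- A bounded operator is approximable if it is an operator-norm limit of finite rank
operators. -/
def IsApproximable {𝕜 : Type v} [RCLike 𝕜] {E F : Type u}
    [NormedAddCommGroup E] [NormedSpace 𝕜 E] [NormedAddCommGroup F] [NormedSpace 𝕜 F]
    (T : E →L[𝕜] F) : Prop :=
  T ∈ closure {S : E →L[𝕜] F | FiniteDimensional 𝕜 (LinearMap.range (S : E →ₗ[𝕜] F))}

/-- A Banach ideal of continuous scalar-valued `n`-homogeneous polynomials over the class of all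
Banach spaces (in the universe `u`) over `𝕜`. The value of `nrm E` matters only on
`space E`. -/
structure PolyIdeal (𝕜 : Type) [RCLike 𝕜] (n : ℕ) where
  /-- the component on the Banach space `E` -/
  space : ∀ (E : Type u) [NormedAddCommGroup E] [NormedSpace 𝕜 E] [CompleteSpace E],
    Submodule 𝕜 (E → 𝕜)
  /-- the ideal norm on the component -/
  nrm : ∀ (E : Type u) [NormedAddCommGroup E] [NormedSpace 𝕜 E] [CompleteSpace E],
    (E → 𝕜) → ℝ
  space_le : ∀ (E : Type u) [NormedAddCommGroup E] [NormedSpace 𝕜 E] [CompleteSpace E],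
    space E ≤ HomPoly 𝕜 n E
  nrm_nonneg : ∀ (E : Type u) [NormedAddCommGroup E] [NormedSpace 𝕜 E] [CompleteSpace E],
    ∀ P ∈ space E, 0 ≤ nrm E P
  nrm_add_le : ∀ (E : Type u) [NormedAddCommGroup E] [NormedSpace 𝕜 E] [CompleteSpace E],
    ∀ P ∈ space E, ∀ Q ∈ space E, nrm E (P + Q) ≤ nrm E P + nrm E Q
  nrm_smul : ∀ (E : Type u) [NormedAddCommGroup E] [NormedSpace 𝕜 E] [CompleteSpace E],
    ∀ (c : 𝕜), ∀ P ∈ space E, nrm E (c • P) = ‖c‖ * nrm E P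
  eq_zero_of_nrm : ∀ (E : Type u) [NormedAddCommGroup E] [NormedSpace 𝕜 E] [CompleteSpace E],
    ∀ P ∈ space E, nrm E P = 0 → P = 0
  /-- every component is complete for its ideal norm -/
  complete : ∀ (E : Type u) [NormedAddCommGroup E] [NormedSpace 𝕜 E] [CompleteSpace E],
    ∀ f : ℕ → E → 𝕜, (∀ k, f k ∈ space E) →
      (∀ ε > 0, ∃ N, ∀ k ≥ N, ∀ l ≥ N, nrm E (f k - f l) < ε) →
      ∃ P ∈ space E, ∀ ε > 0, ∃ N, ∀ k ≥ N, nrm E (f k - P) < ε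
  comp_mem : ∀ (E₁ E : Type u) [NormedAddCommGroup E₁] [NormedSpace 𝕜 E₁] [CompleteSpace E₁]
    [NormedAddCommGroup E] [NormedSpace 𝕜 E] [CompleteSpace E] (T : E₁ →L[𝕜] E),
    ∀ P ∈ space E, P ∘ T ∈ space E₁
  nrm_comp_le : ∀ (E₁ E : Type u) [NormedAddCommGroup E₁] [NormedSpace 𝕜 E₁] [CompleteSpace E₁]
    [NormedAddCommGroup E] [NormedSpace 𝕜 E] [CompleteSpace E] (T : E₁ →L[𝕜] E),
    ∀ P ∈ space E, nrm E₁ (P ∘ T) ≤ nrm E P * ‖T‖ ^ n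
  /-- `z ↦ zⁿ` belongs to the component on the scalar field (lifted to the universe `u`) … -/
  pow_mem : (fun z : ULift.{u} 𝕜 => z.down ^ n) ∈ space (ULift.{u} 𝕜)
  /-- … and has norm one. -/
  nrm_pow : nrm (ULift.{u} 𝕜) (fun z : ULift.{u} 𝕜 => z.down ^ n) = 1

namespace PolyIdeal

variable {𝕜 : Type} [RCLike 𝕜] {n : ℕ}

/-- The set of all numbers `‖R‖_{𝒬(F)} ‖T‖ⁿ` where `P = R ∘ T` is a factorization through a Banach
space `F` with `T : E → F` approximable and `R ∈ 𝒬(F)`. -/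
def factorNorms (𝒬 : PolyIdeal.{u} 𝕜 n) (E : Type u) [NormedAddCommGroup E] [NormedSpace 𝕜 E]
    (P : E → 𝕜) : Set ℝ :=
  {r | ∃ (F : Type u) (_ : NormedAddCommGroup F) (_ : NormedSpace 𝕜 F) (_ : CompleteSpace F)
    (T : E →L[𝕜] F) (R : F → 𝕜),
    IsApproximable T ∧ R ∈ 𝒬.space F ∧ P = R ∘ T ∧ r = 𝒬.nrm F R * ‖T‖ ^ n}

/-- `P` belongs to the minimal kernel `𝒬^min = 𝒬 ∘ 𝔉̄` iff it admits such a factorization. -/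
def MemMin (𝒬 : PolyIdeal.{u} 𝕜 n) (E : Type u) [NormedAddCommGroup E] [NormedSpace 𝕜 E]
    (P : E → 𝕜) : Prop :=
  (𝒬.factorNorms E P).Nonempty

/-- The norm of the minimal kernel: the infimum of `‖R‖_{𝒬(F)} ‖T‖ⁿ` over all factorizations. -/
noncomputable def minNorm (𝒬 : PolyIdeal.{u} 𝕜 n) (E : Type u) [NormedAddCommGroup E]
    [NormedSpace 𝕜 E] (P : E → 𝕜) : ℝ :=
  sInf (𝒬.factorNorms E P)

/-- `𝒬` is minimal if it coincides, with equality of norms, with its minimal kernel. -/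
def IsMinimal (𝒬 : PolyIdeal.{u} 𝕜 n) : Prop :=
  ∀ (E : Type u) [NormedAddCommGroup E] [NormedSpace 𝕜 E] [CompleteSpace E] (P : E → 𝕜),
    (P ∈ 𝒬.space E ↔ 𝒬.MemMin E P) ∧ (P ∈ 𝒬.space E → 𝒬.nrm E P = 𝒬.minNorm E P)

end PolyIdeal

end PolyIdeals

/-!
Write `T'' : E'' → F''` for the bitranspose of an operator `T : E → F` and `J` for the canonical
embedding of a space into its bidual. The Aron–Berner extension is natural,
`AB(R ∘ T) = AB(R) ∘ T''`, and it extends: `AB(P) ∘ J = P`. If `T` is approximable, then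
`T'' = J ∘ U` with `U : E'' → F` approximable and `‖U‖ ≤ ‖T‖`: this is clear for finite sums of
operators `x ↦ f(x) y`, and it passes to norm limits because `U ↦ J ∘ U` is an isometry. So every
factorization `P = R ∘ T` through an approximable operator gives one of the extension,
`AB(P) = AB(R) ∘ J ∘ U = R ∘ U`, at no larger cost; conversely, a factorization of `AB(P)` restricts
along `J` to one of `P = AB(P) ∘ J`. Hence `AB` preserves the norm of the minimal kernel of any
ideal, and a minimal ideal is its own minimal kernel.
-/

namespace PolyIdeals

open NormedSpace

set_option maxSynthPendingDepth 3

section Bitranspose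

variable {𝕜 E F : Type*} [NontriviallyNormedField 𝕜] [SeminormedAddCommGroup E] [NormedSpace 𝕜 E]
  [SeminormedAddCommGroup F] [NormedSpace 𝕜 F]

/-- The bitranspose `T'' : E'' → F''` of a continuous linear map `T : E → F`, as a continuous linear
function of `T`. -/
noncomputable def bitranspose :
    (E →L[𝕜] F) →L[𝕜] (StrongDual 𝕜 (StrongDual 𝕜 E) →L[𝕜] StrongDual 𝕜 (StrongDual 𝕜 F)) :=
  (ContinuousLinearMap.compL 𝕜 (StrongDual 𝕜 F) (StrongDual 𝕜 E) 𝕜).flip ∘L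
    (ContinuousLinearMap.compL 𝕜 E F 𝕜).flip

theorem bitranspose_apply (T : E →L[𝕜] F) (z : StrongDual 𝕜 (StrongDual 𝕜 E))
    (φ : StrongDual 𝕜 F) : bitranspose T z φ = z (φ ∘L T) :=
  rfl

theorem norm_bitranspose_le (T : E →L[𝕜] F) : ‖bitranspose T‖ ≤ ‖T‖ := by
  refine ContinuousLinearMap.opNorm_le_bound₂ _ (norm_nonneg T) fun z φ => ?_
  calc ‖z (φ ∘L T)‖ ≤ ‖z‖ * ‖φ ∘L T‖ := z.le_opNorm _
    _ ≤ ‖z‖ * (‖φ‖ * ‖T‖) := by gcongr; exact φ.opNorm_comp_le T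
    _ = ‖T‖ * ‖z‖ * ‖φ‖ := by ring

theorem bitranspose_smulRight (f : StrongDual 𝕜 E) (y : F) :
    bitranspose (f.smulRight y) =
      inclusionInDoubleDual 𝕜 F ∘L (inclusionInDoubleDual 𝕜 (StrongDual 𝕜 E) f).smulRight y := by
  ext z φ
  have hφ : φ ∘L f.smulRight y = φ y • f := by
    ext x
    simp [mul_comm]
  simp [bitranspose_apply, hφ, mul_comm]

theorem finiteDimensional_range_sum_smulRight {ι : Type*} (s : Finset ι)
    (f : ι → StrongDual 𝕜 E) (y : ι → F) :
    FiniteDimensional 𝕜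
      (LinearMap.range (∑ i ∈ s, (f i).smulRight (y i) : E →L[𝕜] F).toLinearMap) := by
  have hmem : (∑ i ∈ s, (f i).smulRight (y i) : E →L[𝕜] F).toLinearMap ∈
      LinearMap.finiteRange 𝕜 E F := by
    rw [ContinuousLinearMap.toLinearMap_sum]
    exact sum_mem fun i _ => LinearMap.HasNoetherianRange.comp_right (u := (f i).toLinearMap)
      (v := LinearMap.toSpanSingleton 𝕜 F (y i)) .of_isNoetherian_dom
  exact Module.Finite.iff_fg.2 (LinearMap.mem_finiteRange_iff_hasFiniteRange.1 hmem)

end Bitranspose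

section FiniteRank

variable {𝕜 E F : Type*} [NontriviallyNormedField 𝕜] [SeminormedAddCommGroup E] [NormedSpace 𝕜 E]
  [NormedAddCommGroup F] [NormedSpace 𝕜 F]

theorem exists_eq_sum_smulRight [CompleteSpace 𝕜] (S : E →L[𝕜] F)
    [FiniteDimensional 𝕜 (LinearMap.range S.toLinearMap)] :
    ∃ (m : ℕ) (f : Fin m → StrongDual 𝕜 E) (y : Fin m → F), S = ∑ i, (f i).smulRight (y i) := by
  let b := Module.finBasis 𝕜 (LinearMap.range S.toLinearMap)
  let S₀ : E →L[𝕜] LinearMap.range S.toLinearMap :=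
    S.codRestrict _ fun x => LinearMap.mem_range_self S.toLinearMap x
  refine ⟨_, fun i => (b.coord i).toContinuousLinearMap ∘L S₀, fun i => b i, ?_⟩
  ext x
  simpa [S₀] using! congrArg Subtype.val (b.sum_repr (S₀ x)).symm

theorem exists_inclusionInDoubleDual_comp_eq_bitranspose_of_finiteDimensional [CompleteSpace 𝕜]
    (S : E →L[𝕜] F) [FiniteDimensional 𝕜 (LinearMap.range S.toLinearMap)] :
    ∃ U : StrongDual 𝕜 (StrongDual 𝕜 E) →L[𝕜] F,
      FiniteDimensional 𝕜 (LinearMap.range U.toLinearMap) ∧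
        inclusionInDoubleDual 𝕜 F ∘L U = bitranspose S := by
  obtain ⟨m, f, y, rfl⟩ := exists_eq_sum_smulRight S
  refine ⟨_, finiteDimensional_range_sum_smulRight Finset.univ
    (fun i => inclusionInDoubleDual 𝕜 (StrongDual 𝕜 E) (f i)) y, ?_⟩
  simp only [map_sum, bitranspose_smulRight, ContinuousLinearMap.comp_finsetSum]

end FiniteRank

theorem norm_le_of_inclusionInDoubleDual_comp_eq_bitranspose {𝕜 E F : Type*} [RCLike 𝕜]
    [SeminormedAddCommGroup E] [NormedSpace 𝕜 E] [NormedAddCommGroup F] [NormedSpace 𝕜 F]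
    {T : E →L[𝕜] F} {U : StrongDual 𝕜 (StrongDual 𝕜 E) →L[𝕜] F}
    (hU : inclusionInDoubleDual 𝕜 F ∘L U = bitranspose T) : ‖U‖ ≤ ‖T‖ :=
  calc ‖U‖ = ‖inclusionInDoubleDual 𝕜 F ∘L U‖ :=
      (inclusionInDoubleDualLi 𝕜 (E := F)).norm_toContinuousLinearMap_comp.symm
    _ = ‖bitranspose T‖ := by rw [hU]
    _ ≤ ‖T‖ := norm_bitranspose_le T

section Approximable

variable {𝕜 : Type v} [RCLike 𝕜] {E F : Type (max u v)}
  [NormedAddCommGroup E] [NormedSpace 𝕜 E] [NormedAddCommGroup F] [NormedSpace 𝕜 F]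

theorem IsApproximable.comp {E₁ : Type (max u v)} [NormedAddCommGroup E₁] [NormedSpace 𝕜 E₁]
    {T : E →L[𝕜] F} (hT : IsApproximable T) (S : E₁ →L[𝕜] E) : IsApproximable (T ∘L S) := by
  refine map_mem_closure (f := (· ∘L S)) (ContinuousLinearMap.precomp F S).continuous hT
    fun T₀ hT₀ => ?_
  have : FiniteDimensional 𝕜 (LinearMap.range T₀.toLinearMap) := hT₀
  exact Submodule.finiteDimensional_of_le
    (LinearMap.range_comp_le_range S.toLinearMap T₀.toLinearMap)

theorem IsApproximable.exists_inclusionInDoubleDual_comp_eq_bitranspose [CompleteSpace F]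
    {T : E →L[𝕜] F} (hT : IsApproximable T) :
    ∃ U : StrongDual 𝕜 (StrongDual 𝕜 E) →L[𝕜] F, IsApproximable U ∧
      inclusionInDoubleDual 𝕜 F ∘L U = bitranspose T := by
  let postcompJ := (inclusionInDoubleDualLi 𝕜 (E := F)).postcomp
    (E := StrongDual 𝕜 (StrongDual 𝕜 E)) (σ₁₂ := RingHom.id 𝕜)
  have hclosure := map_mem_closure (bitranspose (𝕜 := 𝕜) (E := E) (F := F)).continuous hT
    (t := postcompJ '' {U | FiniteDimensional 𝕜 (LinearMap.range U.toLinearMap)}) fun S hS =>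
      have : FiniteDimensional 𝕜 (LinearMap.range S.toLinearMap) := hS
      exists_inclusionInDoubleDual_comp_eq_bitranspose_of_finiteDimensional S
  rwa [postcompJ.isometry.isClosedEmbedding.closure_image_eq] at hclosure

end Approximable

section AronBerner

universe w

variable {𝕜 : Type v} [RCLike 𝕜] {n : ℕ} {E : Type u} [NormedAddCommGroup E] [NormedSpace 𝕜 E]
  {F : Type w} [NormedAddCommGroup F] [NormedSpace 𝕜 F]

theorem IsAssociatedForm.iteratedFDeriv_zero_apply {P : E → 𝕜}
    {A : ContinuousMultilinearMap 𝕜 (fun _ : Fin n => E) 𝕜} (hA : IsAssociatedForm P A)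
    (v : Fin n → E) : iteratedFDeriv 𝕜 n P 0 v = (n.factorial : 𝕜) * A v := by
  rw [show P = fun x => A fun _ => x from funext hA.2, A.iteratedFDeriv_comp_diagonal]
  simp [hA.1, Fintype.card_perm]

theorem IsAssociatedForm.unique {P : E → 𝕜}
    {A B : ContinuousMultilinearMap 𝕜 (fun _ : Fin n => E) 𝕜}
    (hA : IsAssociatedForm P A) (hB : IsAssociatedForm P B) : A = B := by
  ext v
  have hn : (n.factorial : 𝕜) ≠ 0 := Nat.cast_ne_zero.mpr n.factorial_ne_zero
  exact mul_left_cancel₀ hn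
    ((hA.iteratedFDeriv_zero_apply v).symm.trans (hB.iteratedFDeriv_zero_apply v))

theorem IsAssociatedForm.comp {R : F → 𝕜} {B : ContinuousMultilinearMap 𝕜 (fun _ : Fin n => F) 𝕜}
    (hB : IsAssociatedForm R B) (T : E →L[𝕜] F) :
    IsAssociatedForm (R ∘ T) (B.compContinuousLinearMap fun _ => T) :=
  ⟨fun σ x => hB.1 σ fun i => T (x i), fun x => hB.2 (T x)⟩

theorem comp_mem_homPoly {R : F → 𝕜} (hR : R ∈ HomPoly 𝕜 n F) (T : E →L[𝕜] F) :
    R ∘ T ∈ HomPoly 𝕜 n E :=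
  ⟨_, ((associatedForm_spec hR).comp T).2⟩

theorem multilinearAB_inclusionInDoubleDual (A : ContinuousMultilinearMap 𝕜 (fun _ : Fin n => E) 𝕜)
    (x : Fin n → E) : multilinearAB n A (fun i => inclusionInDoubleDual 𝕜 E (x i)) = A x := by
  induction n with
  | zero => exact congrArg A (Subsingleton.elim _ _)
  | succ n ih =>
    refine (ih _ (Fin.init x)).trans ?_
    simp [Fin.snoc_init_self]

theorem curryRight_compContinuousLinearMap
    (B : ContinuousMultilinearMap 𝕜 (fun _ : Fin (n + 1) => F) 𝕜) (T : E →L[𝕜] F) (x : Fin n → E) :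
    (B.compContinuousLinearMap fun _ => T).curryRight x = B.curryRight (T ∘ x) ∘L T := by
  ext y
  exact congrArg B (Fin.comp_snoc T x y)

theorem multilinearAB_compContinuousLinearMap
    (B : ContinuousMultilinearMap 𝕜 (fun _ : Fin n => F) 𝕜) (T : E →L[𝕜] F)
    (z : Fin n → StrongDual 𝕜 (StrongDual 𝕜 E)) :
    multilinearAB n (B.compContinuousLinearMap fun _ => T) z =
      multilinearAB n B fun i => bitranspose T (z i) := by
  induction n with
  | zero => exact congrArg B (Subsingleton.elim _ _)
  | succ n ih =>
    have hform : (z (Fin.last n)).compContinuousMultilinearMap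
          (B.compContinuousLinearMap fun _ => T).curryRight =
        ((bitranspose T (z (Fin.last n))).compContinuousMultilinearMap
          B.curryRight).compContinuousLinearMap fun _ => T := by
      ext x
      exact congrArg (z (Fin.last n)) (curryRight_compContinuousLinearMap B T x)
    rw [multilinearAB, hform]
    exact ih _ (Fin.init z)

theorem aronBerner_comp_inclusionInDoubleDual {P : E → 𝕜} (hP : P ∈ HomPoly 𝕜 n E) :
    aronBerner hP ∘ inclusionInDoubleDual 𝕜 E = P := by
  ext x
  exact (multilinearAB_inclusionInDoubleDual (associatedForm hP) fun _ => x).trans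
    ((associatedForm_spec hP).2 x).symm

theorem aronBerner_comp {R : F → 𝕜} (hR : R ∈ HomPoly 𝕜 n F) (T : E →L[𝕜] F) :
    aronBerner (comp_mem_homPoly hR T) = aronBerner hR ∘ bitranspose T := by
  have hform : associatedForm (comp_mem_homPoly hR T) =
      (associatedForm hR).compContinuousLinearMap fun _ => T :=
    (associatedForm_spec _).unique ((associatedForm_spec hR).comp T)
  ext z
  rw [aronBerner, hform, multilinearAB_compContinuousLinearMap]
  rfl

theorem aronBerner_comp_of_inclusionInDoubleDual_comp_eq_bitranspose {R : F → 𝕜}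
    (hR : R ∈ HomPoly 𝕜 n F) {T : E →L[𝕜] F} {U : StrongDual 𝕜 (StrongDual 𝕜 E) →L[𝕜] F}
    (hU : inclusionInDoubleDual 𝕜 F ∘L U = bitranspose T) :
    aronBerner (comp_mem_homPoly hR T) = R ∘ U :=
  calc aronBerner (comp_mem_homPoly hR T)
      = aronBerner hR ∘ bitranspose T := aronBerner_comp hR T
    _ = (aronBerner hR ∘ inclusionInDoubleDual 𝕜 F) ∘ U := by rw [← hU]; rfl
    _ = R ∘ U := by rw [aronBerner_comp_inclusionInDoubleDual]

end AronBerner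

namespace PolyIdeal

variable {𝕜 : Type} [RCLike 𝕜] {n : ℕ} {𝒬 : PolyIdeal.{u} 𝕜 n}
  {E E₁ : Type u} [NormedAddCommGroup E] [NormedSpace 𝕜 E] [NormedAddCommGroup E₁]
  [NormedSpace 𝕜 E₁] {P : E → 𝕜}

theorem nonneg_of_mem_factorNorms {r : ℝ} (hr : r ∈ 𝒬.factorNorms E P) : 0 ≤ r := by
  obtain ⟨F, _, _, _, T, R, -, hR, -, rfl⟩ := hr
  exact mul_nonneg (𝒬.nrm_nonneg F R hR) (by positivity)

theorem minNorm_nonneg : 0 ≤ 𝒬.minNorm E P :=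
  Real.sInf_nonneg fun _ => nonneg_of_mem_factorNorms

theorem minNorm_le_of_mem_factorNorms {r : ℝ} (hr : r ∈ 𝒬.factorNorms E P) :
    𝒬.minNorm E P ≤ r :=
  csInf_le ⟨0, fun _ => nonneg_of_mem_factorNorms⟩ hr

theorem MemMin.mem_homPoly (hP : 𝒬.MemMin E P) : P ∈ HomPoly 𝕜 n E := by
  obtain ⟨_, F, _, _, _, T, R, -, hR, rfl, -⟩ := hP
  exact comp_mem_homPoly (𝒬.space_le F hR) T

theorem exists_mem_factorNorms_comp_le (S : E₁ →L[𝕜] E) {r : ℝ} (hr : r ∈ 𝒬.factorNorms E P) :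
    ∃ r₁ ∈ 𝒬.factorNorms E₁ (P ∘ S), r₁ ≤ r * ‖S‖ ^ n := by
  obtain ⟨F, _, _, _, T, R, hT, hR, rfl, rfl⟩ := hr
  refine ⟨_, ⟨F, _, _, ‹_›, T ∘L S, R, hT.comp S, hR, rfl, rfl⟩, ?_⟩
  have hR₀ := 𝒬.nrm_nonneg F R hR
  calc 𝒬.nrm F R * ‖T ∘L S‖ ^ n ≤ 𝒬.nrm F R * (‖T‖ * ‖S‖) ^ n := by
        gcongr
        exact T.opNorm_comp_le S
    _ = 𝒬.nrm F R * ‖T‖ ^ n * ‖S‖ ^ n := by ring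

theorem MemMin.minNorm_comp_le (hP : 𝒬.MemMin E P) (S : E₁ →L[𝕜] E) :
    𝒬.minNorm E₁ (P ∘ S) ≤ 𝒬.minNorm E P * ‖S‖ ^ n := by
  rw [minNorm, minNorm, mul_comm, ← smul_eq_mul, ← Real.sInf_smul_of_nonneg (by positivity)]
  refine le_csInf hP.smul_set ?_
  rintro _ ⟨r, hr, rfl⟩
  obtain ⟨r₁, hr₁, hle⟩ := exists_mem_factorNorms_comp_le S hr
  exact (minNorm_le_of_mem_factorNorms hr₁).trans (hle.trans_eq (mul_comm _ _))

theorem exists_mem_factorNorms_aronBerner_le (hP : P ∈ HomPoly 𝕜 n E) {r : ℝ}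
    (hr : r ∈ 𝒬.factorNorms E P) :
    ∃ r' ∈ 𝒬.factorNorms (StrongDual 𝕜 (StrongDual 𝕜 E)) (aronBerner hP), r' ≤ r := by
  obtain ⟨F, _, _, _, T, R, hT, hR, rfl, rfl⟩ := hr
  obtain ⟨U, hUapprox, hU⟩ := hT.exists_inclusionInDoubleDual_comp_eq_bitranspose
  have hAB : aronBerner hP = R ∘ U :=
    aronBerner_comp_of_inclusionInDoubleDual_comp_eq_bitranspose (𝒬.space_le F hR) hU
  refine ⟨_, ⟨F, _, _, ‹_›, U, R, hUapprox, hR, hAB, rfl⟩, ?_⟩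
  have hR₀ := 𝒬.nrm_nonneg F R hR
  gcongr
  exact norm_le_of_inclusionInDoubleDual_comp_eq_bitranspose hU

theorem MemMin.aronBerner (hP : 𝒬.MemMin E P) :
    𝒬.MemMin (StrongDual 𝕜 (StrongDual 𝕜 E)) (aronBerner hP.mem_homPoly) := by
  obtain ⟨r, hr⟩ := hP
  obtain ⟨r', hr', -⟩ := exists_mem_factorNorms_aronBerner_le (MemMin.mem_homPoly ⟨r, hr⟩) hr
  exact ⟨r', hr'⟩

theorem MemMin.minNorm_aronBerner_le (hP : 𝒬.MemMin E P) :
    𝒬.minNorm (StrongDual 𝕜 (StrongDual 𝕜 E)) (PolyIdeals.aronBerner hP.mem_homPoly) ≤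
      𝒬.minNorm E P := by
  refine le_csInf hP fun r hr => ?_
  obtain ⟨r', hr', hle⟩ := exists_mem_factorNorms_aronBerner_le hP.mem_homPoly hr
  exact (minNorm_le_of_mem_factorNorms hr').trans hle

theorem MemMin.le_minNorm_aronBerner (hP : 𝒬.MemMin E P) :
    𝒬.minNorm E P ≤
      𝒬.minNorm (StrongDual 𝕜 (StrongDual 𝕜 E)) (PolyIdeals.aronBerner hP.mem_homPoly) := by
  have h := hP.aronBerner.minNorm_comp_le (inclusionInDoubleDual 𝕜 E)
  rw [aronBerner_comp_inclusionInDoubleDual] at h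
  refine h.trans (mul_le_of_le_one_right minNorm_nonneg ?_)
  exact pow_le_one₀ (norm_nonneg _) (inclusionInDoubleDual_norm_le 𝕜 E)

end PolyIdeal

end PolyIdeals

theorem corollary3p8_general {𝕜 : Type} [RCLike 𝕜] {n : ℕ} (𝒬 : PolyIdeals.PolyIdeal.{u} 𝕜 n)
    (E : Type u) [NormedAddCommGroup E] [NormedSpace 𝕜 E] (P : E → 𝕜) (hP : 𝒬.MemMin E P) :
    𝒬.MemMin (StrongDual 𝕜 (StrongDual 𝕜 E)) (PolyIdeals.aronBerner hP.mem_homPoly) ∧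
      𝒬.minNorm (StrongDual 𝕜 (StrongDual 𝕜 E)) (PolyIdeals.aronBerner hP.mem_homPoly) =
        𝒬.minNorm E P :=
  ⟨hP.aronBerner, hP.minNorm_aronBerner_le.antisymm hP.le_minNorm_aronBerner⟩

theorem corollary3p8 {𝕜 : Type} [RCLike 𝕜] {n : ℕ} (𝒬 : PolyIdeals.PolyIdeal.{u} 𝕜 n)
    (h𝒬 : 𝒬.IsMinimal) (E : Type u) [NormedAddCommGroup E] [NormedSpace 𝕜 E] [CompleteSpace E]
    (P : E → 𝕜) (hP : P ∈ 𝒬.space E) :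
    PolyIdeals.aronBerner (𝒬.space_le E hP) ∈ 𝒬.space (StrongDual 𝕜 (StrongDual 𝕜 E)) ∧
      𝒬.nrm (StrongDual 𝕜 (StrongDual 𝕜 E)) (PolyIdeals.aronBerner (𝒬.space_le E hP)) =
        𝒬.nrm E P := by
  obtain ⟨hmin, hnorm⟩ := corollary3p8_general 𝒬 E P ((h𝒬 E P).1.1 hP)
  have hmem := (h𝒬 _ _).1.2 hmin
  exact ⟨hmem, ((h𝒬 _ _).2 hmem).trans (hnorm.trans ((h𝒬 E P).2 hP).symm)⟩
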